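/- Proposition. Fix an arm with reward mean $\mu\in\mathbb R$ and standard deviation $\sigma\ge 0$, surrogate mean $\tilde\mu\in\mathbb R$ and standard deviation $\tilde\sigma>0$, and correlation $\rho\in[-1,1]$. Let $n\ge 2$ and $N\ge 0$ be fixed (deterministic) integers. The online pairs $(R_s,\hat R_s)$, $s=1,2,\dots$, of true and surrogate rewards are i.i.d. with $$\begin{pmatrix}R_s\\ \hat R_s\end{pmatrix}\sim\mathcal N\left(\begin{pmatrix}\mu\\ \tilde\mu\end{pmatrix},\begin{pmatrix}\sigma^2&\rho\sigma\tilde\sigma\\ \rho\sigma\tilde\sigma&\tilde\sigma^2\end{pmatrix}\right),$$ and the offline surrogate rewards $\hat R^{\mathrm{off}}_1,\dots,\hat R^{\mathrm{off}}_N$ are i.i.d. $\mathcal N(\tilde\mu,\tilde\sigma^2)$ and independent of the online pairs. Put $$\mathbb E_n[R]=\frac1n\sum_{s=1}^nR_s,\quad \mathbb E_n[\hat R]=\frac1n\sum_{s=1}^n\hat R_s,\quad \mathbb E^{\mathrm{off}}[\hat R]=\frac1N\sum_{s=1}^N\hat R^{\mathrm{off}}_s,\quad \mathbb E^{\mathrm{all}}[\hat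 R]=\frac1{n+N}\Big(\sum_{s=1}^n\hat R_s+\sum_{s=1}^N\hat R_s^{\mathrm{off}}\Big),$$ $$\hat\lambda=\frac{N}{n+N}\cdot\frac{\frac1n\sum_{s=1}^n(R_s-\mathbb E_n[R])(\hat R_s-\mathbb E_n[\hat R])}{\frac1n\sum_{s=1}^n(\hat R_s-\mathbb E_n[\hat R])^2},\qquad \hat\mu=\mathbb E_n[R]-\hat\lambda\big(\mathbb E_n[\hat R]-\mathbb E^{\mathrm{off}}[\hat R]\big)$$ (for $N=0$ the correction term is zero, so $\hat\mu=\mathbb E_n[R]$; quotients are set to $0$ on the null event where their denominator vanishes), let $$\mathcal F=\sigma\big(\hat R^{\mathrm{off}}_1,\dots,\hat R^{\mathrm{off}}_N,\hat R_1,\dots,\hat R_n\big),\qquad Z=1+\frac{n\big(\mathbb E_n[\hat R]-\mathbb E^{\mathrm{all}}[\hat R]\big)^2}{\sum_{s=1}^n(\hat R_s-\mathbb E_n[\hat R])^2}.$$ Then $Z$ is $\mathcal F$-measurable, and there are random variables $S_1,S_2$ with $$\hat\mu=\mu+S_1+S_2$$ such that $S_1$ and $S_2$ are independent, $S_1$ is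 $\mathcal F$-measurable, and $$S_1\sim\mathcal N\Big(0,\frac{1}{n+N}\rho^2\sigma^2\Big),\qquad S_2\mid\mathcal F\sim\mathcal N\Big(0,\frac1n Z(1-\rho^2)\sigma^2\Big),$$ where a Gaussian law with variance $0$ is the point mass at its mean. -/

import Mathlib

open MeasureTheory ProbabilityTheory

noncomputable section

namespace SurrogateBandit

/-- The data of one arm: online pairs of true and surrogate rewards `(R s, Rhat s)`, where the
index `s = 0, 1, 2, …` stands for the pull number `s + 1`, and a pool of `N` offline surrogate
rewards `Roff i`. The online pairs are i.i.d. bivariate Gaussian, the offline surrogate rewards are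
i.i.d. with the same law as an online surrogate reward, and the offline pool is independent of the
online sequence. Here `μ, σ` are the mean and standard deviation of the true reward, `μt, σt`
those of the surrogate reward, and `ρ` is the correlation coefficient. -/
structure GaussianArm {Ω : Type*} [MeasurableSpace Ω] (P : Measure Ω) {N : ℕ}
    (R Rhat : ℕ → Ω → ℝ) (Roff : Fin N → Ω → ℝ) (μ μt σ σt ρ : ℝ) : Prop where
  measurable_reward : ∀ s, Measurable (R s)
  measurable_surrogate : ∀ s, Measurable (Rhat s)
  measurable_offline : ∀ i, Measurable (Roff i)
  law_pair : ∀ s, HasLaw (fun ω => !₂[R s ω, Rhat s ω])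
    (multivariateGaussian !₂[μ, μt]
      !![σ ^ 2, ρ * σ * σt;
         ρ * σ * σt, σt ^ 2]) P
  law_offline : ∀ i, HasLaw (Roff i) (gaussianReal μt (σt ^ 2).toNNReal) P
  indep_pairs : iIndepFun (fun s ω => (R s ω, Rhat s ω)) P
  indep_offline : iIndepFun Roff P
  indep_offline_online :
    IndepFun (fun ω i => Roff i ω) (fun ω s => (R s ω, Rhat s ω)) P

/-- Mean of the first `n` terms of a sequence. -/
def onlineMean (n : ℕ) (x : ℕ → ℝ) : ℝ :=
  (1 / (n : ℝ)) * ∑ s ∈ Finset.range n, x s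

/-- Mean of the offline surrogate rewards. -/
def offlineMean {N : ℕ} (y : Fin N → ℝ) : ℝ :=
  (1 / (N : ℝ)) * ∑ i, y i

/-- Mean of the first `n` online and all `N` offline surrogate rewards. -/
def pooledMean (n : ℕ) {N : ℕ} (x : ℕ → ℝ) (y : Fin N → ℝ) : ℝ :=
  (1 / ((n : ℝ) + N)) * (∑ s ∈ Finset.range n, x s + ∑ i, y i)

/-- Sample covariance of true and surrogate rewards over the first `n` pulls. -/
def sampleCov (n : ℕ) (r x : ℕ → ℝ) : ℝ :=
  (1 / (n : ℝ)) * ∑ s ∈ Finset.range n, (r s - onlineMean n r) * (x s - onlineMean n x)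

/-- Sample variance of the surrogate rewards over the first `n` pulls. -/
def sampleVar (n : ℕ) (x : ℕ → ℝ) : ℝ :=
  (1 / (n : ℝ)) * ∑ s ∈ Finset.range n, (x s - onlineMean n x) ^ 2

/-- The empirical tuning coefficient. -/
def lambdaHat (n N : ℕ) (r x : ℕ → ℝ) : ℝ :=
  ((N : ℝ) / ((n : ℝ) + N)) * (sampleCov n r x / sampleVar n x)

/-- The machine-learning-assisted mean estimator. -/
def mlaMean (n : ℕ) {N : ℕ} (r x : ℕ → ℝ) (y : Fin N → ℝ) : ℝ :=
  onlineMean n r - lambdaHat n N r x * (onlineMean n x - offlineMean y)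

/-- The variance inflation statistic of the surrogate rewards. -/
def zStat (n : ℕ) {N : ℕ} (x : ℕ → ℝ) (y : Fin N → ℝ) : ℝ :=
  1 + n * (onlineMean n x - pooledMean n x y) ^ 2 /
    ∑ s ∈ Finset.range n, (x s - onlineMean n x) ^ 2

/-- The σ-field generated by the `N` offline and the first `n` online surrogate rewards. -/
abbrev surrogateField {Ω : Type*} (n : ℕ) {N : ℕ} (Rhat : ℕ → Ω → ℝ) (Roff : Fin N → Ω → ℝ) :
    MeasurableSpace Ω :=
  (⨆ i : Fin N, MeasurableSpace.comap (Roff i) inferInstance) ⊔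
    ⨆ s : Fin n, MeasurableSpace.comap (Rhat s) inferInstance

/-- `S | F ∼ 𝒩(0, v)` for an `F`-measurable random variance `v`: for every Borel set `B`, the
conditional probability of `S ∈ B` given `F` is almost surely the mass that the centred Gaussian
law with variance `v ω` gives to `B`. -/
def CondCentredGaussian {Ω : Type*} [MeasurableSpace Ω] (P : Measure Ω) (F : MeasurableSpace Ω)
    (S v : Ω → ℝ) : Prop :=
  Measurable[F] v ∧ (∀ᵐ ω ∂P, 0 ≤ v ω) ∧
    ∀ B : Set ℝ, MeasurableSet B →
      P⟦S ⁻¹' B | F⟧ =ᵐ[P] fun ω => (gaussianReal 0 (v ω).toNNReal).real B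

end SurrogateBandit

end

/-! Regress the true reward on the surrogate. With β = ρσ/σt the residuals e_s = R_s - μ - β(Rhat_s
- μt) are uncorrelated with the surrogates, hence, by joint normality, independent of all of them,
and they are i.i.d. N(0, (1-ρ²)σ²). The empirical slope is β plus the slope C/Q of the residuals on
the surrogates. Its β part turns the online surrogate mean into the pooled one, so
(`mlaMean_decomposition`) the error of the estimator is S₁ + S₂, with S₁ = β(pooled mean - μt) and
S₂ = ∑ w_s e_s for weights w_s that depend on the surrogates only.

Given F the weights are frozen and the residuals keep their law, so S₂ is centred Gaussian with
variance (∑ w_s²)(1-ρ²)σ² (`condCentredGaussian_sum_mul`), and ∑ w_s² = Z/n because deviations from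
the online mean sum to zero (`sum_residualWeight_sq`).

Independence of S₁ and S₂ needs more, since the conditional variance of S₂ is random and
F-measurable like S₁. But Z depends only on deviations from the pooled mean, which are independent
of that mean (`indepFun_pooledMean_zStat`); then `CondCentredGaussian.indepFun` applies. -/

namespace SurrogateBandit

/-! ### Conditionally Gaussian variables. -/

variable {Ω : Type*} {F : MeasurableSpace Ω} [mΩ : MeasurableSpace Ω] {P : Measure Ω}

/-- A linear combination of independent centred Gaussian variables is centred Gaussian. -/
lemma hasLaw_sum_mul_gaussianReal {ι : Type*} [Fintype ι] {X : ι → Ω → ℝ} {v : ℝ} (hv : 0 ≤ v)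
    (hlaw : ∀ i, HasLaw (X i) (gaussianReal 0 v.toNNReal) P) (hind : iIndepFun X P) (c : ι → ℝ) :
    HasLaw (fun ω => ∑ i, c i * X i ω) (gaussianReal 0 ((∑ i, c i ^ 2) * v).toNNReal) P := by
  have := hind.isProbabilityMeasure
  have hY (i) := gaussianReal_const_mul (hlaw i) (c i)
  have hindY : iIndepFun (fun i ω => c i * X i ω) P :=
    hind.comp (fun i x => c i * x) (by fun_prop)
  have hg : HasGaussianLaw (fun ω => ∑ i, c i * X i ω) P :=
    hindY.hasGaussianLaw_fun_sum fun i => (hY i).hasGaussianLaw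
  have hL2 (i) : MemLp (fun ω => c i * X i ω) 2 P := (hY i).hasGaussianLaw.memLp_two
  refine ⟨hg.aemeasurable, ?_⟩
  rw [hg.map_eq_gaussianReal]
  congr 1
  · rw [integral_finsetSum _ fun i _ => (hY i).hasGaussianLaw.integrable]
    refine Finset.sum_eq_zero fun i _ => ?_
    rw [(hY i).integral_eq, integral_id_gaussianReal, mul_zero]
  · congr 1
    rw [variance_fun_sum' (fun i _ => hL2 i), Finset.sum_mul]
    refine Finset.sum_congr rfl fun i _ => ?_
    rw [Finset.sum_eq_single_of_mem i (Finset.mem_univ i) fun j _ hij =>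
      (hindY.indepFun hij.symm).covariance_eq_zero (hL2 i) (hL2 j),
      covariance_self (hL2 i).aemeasurable, (hY i).variance_eq, variance_id_gaussianReal]
    simp [hv]

lemma measurable_gaussianReal_real {B : Set ℝ} (hB : MeasurableSet B) :
    Measurable fun v : ℝ => (gaussianReal 0 v.toNNReal).real B := by
  have h : Measurable fun v : ℝ => gaussianReal 0 v.toNNReal := by fun_prop
  exact ((Measure.measurable_coe hB).comp h).ennreal_toReal

/-- A combination of i.i.d. centred Gaussian variables with random coefficients that are measurable
with respect to a σ-field independent of these variables is conditionally Gaussian. -/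
lemma condCentredGaussian_sum_mul [IsProbabilityMeasure P] {ι : Type*} [Fintype ι] (hF : F ≤ mΩ) {X c : ι → Ω → ℝ} {S : Ω → ℝ} {v : ℝ} (hv : 0 ≤ v)
    (hX : ∀ i, Measurable (X i))
    (hlaw : ∀ i, HasLaw (X i) (gaussianReal 0 v.toNNReal) P) (hind : iIndepFun X P)
    (hc : ∀ i, Measurable[F] (c i))
    (hFX : Indep F (MeasurableSpace.comap (fun ω i => X i ω) MeasurableSpace.pi) P)
    (hSm : Measurable S) (hS : S =ᵐ[P] fun ω => ∑ i, c i ω * X i ω) :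
    CondCentredGaussian P F S fun ω => (∑ i, c i ω ^ 2) * v := by
  have hvar : Measurable[F] fun ω => (∑ i, c i ω ^ 2) * v :=
    (Finset.measurable_sum _ fun i _ => (hc i).pow_const 2).mul_const v
  refine ⟨hvar, ae_of_all _ fun ω => by positivity, fun B hB => ?_⟩
  have hgm : Measurable[F] fun ω => (gaussianReal 0 ((∑ i, c i ω ^ 2) * v).toNNReal).real B :=
    (measurable_gaussianReal_real hB).comp hvar
  have hint : Integrable (fun ω => (gaussianReal 0 ((∑ i, c i ω ^ 2) * v).toNNReal).real B) P :=
    Integrable.of_bound (hgm.mono hF le_rfl).aestronglyMeasurable 1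
      (ae_of_all _ fun ω => by
        rw [Real.norm_of_nonneg measureReal_nonneg]; exact measureReal_le_one)
  symm
  refine ae_eq_condExp_of_forall_setIntegral_eq hF
    ((integrable_const (1 : ℝ)).indicator (hSm hB)) (fun A _ _ => hint.integrableOn)
    (fun A hA _ => ?_) hgm.stronglyMeasurable.aestronglyMeasurable
  classical
  -- The indicator of `A` is bundled with the coefficients: the event `A ∩ S ⁻¹' B` then depends on
  -- the pair (`U`, `X`), whose law is a product, and Fubini freezes the coefficients.
  let U : Ω → ℝ × (ι → ℝ) := fun ω => (A.indicator 1 ω, fun i => c i ω)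
  have hUF : Measurable[F] U :=
    Measurable.prodMk (Measurable.indicator (m := F) measurable_const hA)
      (@measurable_pi_lambda _ _ _ F _ _ hc)
  have hU : Measurable U := hUF.mono hF le_rfl
  have hXm : Measurable fun ω i => X i ω := measurable_pi_lambda _ hX
  have hUX : IndepFun U (fun ω i => X i ω) P :=
    indep_of_indep_of_le_left hFX hUF.comap_le
  let D : Set ((ℝ × (ι → ℝ)) × (ι → ℝ)) := {p | p.1.1 = 1 ∧ ∑ i, p.1.2 i * p.2 i ∈ B}
  have hD : MeasurableSet D := by
    refine MeasurableSet.inter ?_ ?_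
    · exact measurableSet_eq_fun (by fun_prop) measurable_const
    · exact (show Measurable fun p : (ℝ × (ι → ℝ)) × (ι → ℝ) => ∑ i, p.1.2 i * p.2 i by
        fun_prop) hB
  have hAm : MeasurableSet A := hF A hA
  have key : P (A ∩ S ⁻¹' B) =
      ∫⁻ ω in A, gaussianReal 0 ((∑ i, c i ω ^ 2) * v).toNNReal B ∂P := by
    have h1 : P (A ∩ S ⁻¹' B) = P.map (fun ω => (U ω, fun i => X i ω)) D := by
      rw [Measure.map_apply (hU.prodMk hXm) hD]
      refine measure_congr ?_
      filter_upwards [hS] with ω hω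
      refine propext ?_
      change (ω ∈ A ∧ S ω ∈ B) ↔ (A.indicator (1 : Ω → ℝ) ω = 1 ∧ ∑ i, c i ω * X i ω ∈ B)
      rw [hω]
      by_cases h : ω ∈ A <;> simp [h]
    rw [h1, (indepFun_iff_map_prod_eq_prod_map_map hU.aemeasurable hXm.aemeasurable).1 hUX,
      Measure.prod_apply hD, lintegral_map (measurable_measure_prodMk_left hD) hU,
      ← lintegral_indicator hAm]
    refine lintegral_congr fun ω => ?_
    by_cases h : ω ∈ A
    · rw [Set.indicator_of_mem h, ← (hasLaw_sum_mul_gaussianReal hv hlaw hind (c · ω)).map_eq,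
        Measure.map_apply hXm (measurable_prodMk_left hD), Measure.map_apply (by fun_prop) hB]
      congr 1
      ext ω'
      simp [D, U, h]
    · rw [Set.indicator_of_notMem h, Measure.map_apply hXm (measurable_prodMk_left hD)]
      convert! measure_empty (μ := P)
      ext ω'
      simp [D, U, h]
  rw [integral_indicator (hSm hB), setIntegral_const, smul_eq_mul, mul_one,
    measureReal_restrict_apply (hSm hB), Set.inter_comm, Measure.real, key]
  exact integral_toReal (((Measure.measurable_coe hB).comp (by fun_prop :
    Measurable fun v : ℝ => gaussianReal 0 v.toNNReal)).comp
      (hvar.mono hF le_rfl)).aemeasurable (ae_of_all _ fun ω => measure_lt_top _ _)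

/-- If the conditional law of `S` given `F` is Gaussian with a random variance independent of the
`F`-measurable variable `T`, then `S` is independent of `T`. -/
lemma CondCentredGaussian.indepFun [IsProbabilityMeasure P] (hF : F ≤ mΩ)
    {S T v : Ω → ℝ} (h : CondCentredGaussian P F S v) (hS : Measurable S) (hT : Measurable[F] T)
    (hTv : IndepFun T v P) : IndepFun T S P := by
  rw [indepFun_iff_measure_inter_preimage_eq_mul]
  intro A B hA hB
  have hTA : MeasurableSet (T ⁻¹' A) := hF _ (hT hA)
  let κ : ℝ → ℝ := fun v => (gaussianReal 0 v.toNNReal).real B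
  have hκ : Measurable κ := measurable_gaussianReal_real hB
  have hI : Integrable ((S ⁻¹' B).indicator fun _ => (1 : ℝ)) P :=
    (integrable_const (1 : ℝ)).indicator (hS hB)
  -- The defining property of the conditional probability: joint probabilities with events of `F`
  -- are integrals of `κ (v ω)`.
  have hmass {C : Set Ω} (hC : MeasurableSet[F] C) :
      P.real (C ∩ S ⁻¹' B) = ∫ ω in C, κ (v ω) ∂P := by
    rw [← setIntegral_congr_ae (g := fun ω => κ (v ω)) (hF C hC)
      ((h.2.2 B hB).mono fun ω hω _ => hω), setIntegral_condExp hF hI hC,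
      setIntegral_indicator (hS hB)]
    simp
  have h1 := hmass (hT hA)
  have h2 := hmass (C := Set.univ) MeasurableSet.univ
  -- Independence of `T` and `v` factors E[1_A(T) κ(v)] into P(T ∈ A) E[κ(v)], and E[κ(v)] = P(S ∈
  -- B) by `hmass` on the whole space.
  have h3 := (hTv.comp (φ := A.indicator fun _ => (1 : ℝ)) (ψ := κ)
    (measurable_const.indicator hA) hκ).integral_fun_mul_eq_mul_integral
    (((measurable_const.indicator hA).comp (hT.mono hF le_rfl)).aestronglyMeasurable)
    ((hκ.comp (h.1.mono hF le_rfl)).aestronglyMeasurable)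
  have h4 (ω) : (A.indicator (fun _ => (1 : ℝ)) ∘ T) ω * (κ ∘ v) ω =
      (T ⁻¹' A).indicator (fun ω => κ (v ω)) ω := by
    by_cases hω : T ω ∈ A <;> simp [hω, Set.indicator]
  have h5 : ∫ ω, (A.indicator (fun _ => (1 : ℝ)) ∘ T) ω ∂P = P.real (T ⁻¹' A) := by
    rw [← integral_indicator_one hTA]
    rfl
  rw [h5, integral_congr_ae (ae_of_all _ h4), integral_indicator hTA, ← h1] at h3
  rw [Set.univ_inter, setIntegral_univ] at h2
  change _ = _ * ∫ ω, κ (v ω) ∂P at h3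
  rw [← h2] at h3
  rw [← ENNReal.toReal_eq_toReal_iff' (by finiteness) (by finiteness), ENNReal.toReal_mul]
  exact h3

end SurrogateBandit

/-! ### Joint Gaussian structure of residuals and surrogates. -/

namespace SurrogateBandit

variable {Ω : Type*} [mΩ : MeasurableSpace Ω] {P : Measure Ω}

/-- For i.i.d. Gaussian variables the sum is independent of the deviations from the mean. -/
lemma indepFun_sum_sub_mean {ι : Type*} [Fintype ι] {W : ι → Ω → ℝ} {m : ℝ} {v : NNReal}
    (hlaw : ∀ i, HasLaw (W i) (gaussianReal m v) P) (hind : iIndepFun W P) :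
    IndepFun (fun ω => ∑ i, W i ω)
      (fun ω j => W j ω - (1 / (Fintype.card ι : ℝ)) * ∑ i, W i ω) P := by
  classical
  have := hind.isProbabilityMeasure
  have hW : HasGaussianLaw (fun ω i => W i ω) P :=
    hind.hasGaussianLaw fun i => (hlaw i).hasGaussianLaw
  have hL2 (i) : MemLp (W i) 2 P := (hlaw i).hasGaussianLaw.memLp_two
  have hsum : MemLp (fun ω => ∑ i, W i ω) 2 P := memLp_finsetSum _ fun i _ => hL2 i
  let pr (i : ι) : (ι → ℝ) →L[ℝ] ℝ := ContinuousLinearMap.proj i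
  -- The sum is viewed as a family over `Unit` to fit the covariance criterion for independence of
  -- two jointly Gaussian families.
  let L : (ι → ℝ) →L[ℝ] (Unit → ℝ) × (ι → ℝ) :=
    (ContinuousLinearMap.pi fun _ => ∑ i, pr i).prod
      (ContinuousLinearMap.pi fun j => pr j - (1 / (Fintype.card ι : ℝ)) • ∑ i, pr i)
  have hL : HasGaussianLaw (fun ω => ((fun _ => ∑ i, W i ω : Unit → ℝ),
      fun j => W j ω - (1 / (Fintype.card ι : ℝ)) * ∑ i, W i ω)) P := by
    convert! hW.map_fun L using 2 with ω
    ext <;> simp [L, pr]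
  have hcov (i j) : cov[W i, W j; P] = if i = j then (v : ℝ) else 0 := by
    split_ifs with h
    · subst h
      rw [covariance_self (hL2 i).aemeasurable, (hlaw i).variance_eq, variance_id_gaussianReal]
    · exact (hind.indepFun h).covariance_eq_zero (hL2 i) (hL2 j)
  refine (hL.indepFun_of_covariance_eval fun _ j => ?_).comp
    (φ := fun f : Unit → ℝ => f ()) (measurable_pi_apply ()) measurable_id
  have hcard : (Fintype.card ι : ℝ) ≠ 0 := by
    have : Nonempty ι := ⟨j⟩
    exact_mod_cast Fintype.card_ne_zero
  -- With k variables the covariance is v - (1/k)·k·v = 0.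
  rw [covariance_fun_sub_right hsum (hL2 j) (hsum.const_mul _), covariance_const_mul_right,
    covariance_fun_sum_fun_sum hL2 hL2, covariance_fun_sum_left hL2 (hL2 j)]
  simp [hcov, hcard]

lemma posSemidef_covMatrix {σ σt ρ : ℝ} (hρ : |ρ| ≤ 1) :
    (!![σ ^ 2, ρ * σ * σt; ρ * σ * σt, σt ^ 2] : Matrix (Fin 2) (Fin 2) ℝ).PosSemidef := by
  refine Matrix.PosSemidef.of_dotProduct_mulVec_nonneg ?_ fun x => ?_
  · ext i j
    fin_cases i <;> fin_cases j <;> simp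
  · have hρ2 : 0 ≤ 1 - ρ ^ 2 := by
      have := (sq_le_one_iff_abs_le_one ρ).2 hρ
      linarith
    have h : star x ⬝ᵥ (!![σ ^ 2, ρ * σ * σt; ρ * σ * σt, σt ^ 2]).mulVec x =
        (ρ * σ * x 0 + σt * x 1) ^ 2 + (1 - ρ ^ 2) * (σ * x 0) ^ 2 := by
      simp [dotProduct, Matrix.mulVec, Fin.sum_univ_two]
      ring
    rw [h]
    positivity

namespace GaussianArm

variable {N : ℕ} {R Rhat : ℕ → Ω → ℝ} {Roff : Fin N → Ω → ℝ} {μ μt σ σt ρ : ℝ}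

lemma hasGaussianLaw_pair (harm : GaussianArm P R Rhat Roff μ μt σ σt ρ) (s : ℕ) :
    HasGaussianLaw (fun ω => (R s ω, Rhat s ω)) P := by
  have h := (harm.law_pair s).hasGaussianLaw.map_fun
    ((EuclideanSpace.proj (0 : Fin 2) : EuclideanSpace ℝ (Fin 2) →L[ℝ] ℝ).prod
      (EuclideanSpace.proj (1 : Fin 2)))
  simpa using h

lemma law_reward (harm : GaussianArm P R Rhat Roff μ μt σ σt ρ) (hρ : |ρ| ≤ 1) (s : ℕ) :
    HasLaw (R s) (gaussianReal μ (σ ^ 2).toNNReal) P := by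
  simpa using (measurePreserving_eval_multivariateGaussian (posSemidef_covMatrix hρ)
    (i := 0)).fun_comp_hasLaw (harm.law_pair s)

lemma law_surrogate (harm : GaussianArm P R Rhat Roff μ μt σ σt ρ) (hρ : |ρ| ≤ 1) (s : ℕ) :
    HasLaw (Rhat s) (gaussianReal μt (σt ^ 2).toNNReal) P := by
  simpa using (measurePreserving_eval_multivariateGaussian (posSemidef_covMatrix hρ)
    (i := 1)).fun_comp_hasLaw (harm.law_pair s)

lemma covariance_reward_surrogate (harm : GaussianArm P R Rhat Roff μ μt σ σt ρ) (hρ : |ρ| ≤ 1)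
    (s : ℕ) : cov[R s, Rhat s; P] = ρ * σ * σt := by
  have h := (harm.law_pair s).covariance_fun_comp (f := fun x => x 0) (g := fun x => x 1)
    (by fun_prop) (by fun_prop)
  rw [covariance_eval_multivariateGaussian (posSemidef_covMatrix hρ)] at h
  simpa using h

end GaussianArm

/-- The residual of the regression of the true reward on the surrogate reward. -/
def residual (R Rhat : ℕ → Ω → ℝ) (μ μt β : ℝ) (s : ℕ) (ω : Ω) : ℝ :=
  R s ω - μ - β * (Rhat s ω - μt)

/-- The first `n` online and the `N` offline surrogate rewards as one family. -/
def surrogates (n : ℕ) {N : ℕ} (Rhat : ℕ → Ω → ℝ) (Roff : Fin N → Ω → ℝ) :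
    Fin n ⊕ Fin N → Ω → ℝ :=
  Sum.elim (fun s => Rhat s) Roff

namespace GaussianArm

variable {N : ℕ} {R Rhat : ℕ → Ω → ℝ} {Roff : Fin N → Ω → ℝ} {μ μt σ σt ρ : ℝ}

lemma measurable_residual (harm : GaussianArm P R Rhat Roff μ μt σ σt ρ) (β : ℝ) (s : ℕ) :
    Measurable (residual R Rhat μ μt β s) :=
  ((harm.measurable_reward s).sub_const μ).sub
    (((harm.measurable_surrogate s).sub_const μt).const_mul β)

lemma measurable_surrogates (harm : GaussianArm P R Rhat Roff μ μt σ σt ρ) (n : ℕ) (j) :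
    Measurable (surrogates n Rhat Roff j) := by
  cases j with
  | inl s => exact harm.measurable_surrogate s
  | inr i => exact harm.measurable_offline i

lemma law_surrogates (harm : GaussianArm P R Rhat Roff μ μt σ σt ρ) (hρ : |ρ| ≤ 1) (n : ℕ) (j) :
    HasLaw (surrogates n Rhat Roff j) (gaussianReal μt (σt ^ 2).toNNReal) P := by
  cases j with
  | inl s => exact harm.law_surrogate hρ s
  | inr i => exact harm.law_offline i

lemma hasGaussianLaw_residual [IsProbabilityMeasure P]
    (harm : GaussianArm P R Rhat Roff μ μt σ σt ρ) (β : ℝ) (s : ℕ) :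
    HasGaussianLaw (residual R Rhat μ μt β s) P := by
  have h : HasGaussianLaw (fun ω => R s ω - β * Rhat s ω) P := by
    simpa using (harm.hasGaussianLaw_pair s).map_fun
      (ContinuousLinearMap.fst ℝ ℝ ℝ - β • ContinuousLinearMap.snd ℝ ℝ ℝ)
  have h' := gaussianReal_sub_const ⟨h.aemeasurable, h.map_eq_gaussianReal⟩ (μ - β * μt)
  convert! h'.hasGaussianLaw using 1
  ext ω
  simp only [residual]
  ring

lemma covariance_residual [IsProbabilityMeasure P]
    (harm : GaussianArm P R Rhat Roff μ μt σ σt ρ) (hρ : |ρ| ≤ 1) (β : ℝ) (s : ℕ)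
    {Y : Ω → ℝ} (hY : MemLp Y 2 P) :
    cov[residual R Rhat μ μt β s, Y; P] = cov[R s, Y; P] - β * cov[Rhat s, Y; P] := by
  have hR := (harm.law_reward hρ s).hasGaussianLaw
  have hRh := (harm.law_surrogate hρ s).hasGaussianLaw
  have h1 : MemLp (fun ω => R s ω - μ) 2 P := hR.memLp_two.sub (memLp_const μ)
  have h2 : MemLp (fun ω => Rhat s ω - μt) 2 P := hRh.memLp_two.sub (memLp_const μt)
  unfold residual
  rw [covariance_fun_sub_left h1 (h2.const_mul β) hY, covariance_const_mul_left]
  congr 1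
  · exact covariance_sub_const_left hR.integrable μ
  · congr 1
    exact covariance_sub_const_left hRh.integrable μt

/-- This fixes the slope: ρσσt - βσt² vanishes exactly for β = ρσ/σt. -/
lemma covariance_residual_surrogate [IsProbabilityMeasure P]
    (harm : GaussianArm P R Rhat Roff μ μt σ σt ρ) (hρ : |ρ| ≤ 1) (hσt : 0 < σt) (s : ℕ) :
    cov[residual R Rhat μ μt (ρ * σ / σt) s, Rhat s; P] = 0 := by
  have hRh := harm.law_surrogate hρ s
  rw [harm.covariance_residual hρ _ s hRh.hasGaussianLaw.memLp_two,
    harm.covariance_reward_surrogate hρ, covariance_self hRh.aemeasurable, hRh.variance_eq,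
    variance_id_gaussianReal, Real.coe_toNNReal _ (by positivity)]
  field_simp
  ring

lemma law_residual [IsProbabilityMeasure P]
    (harm : GaussianArm P R Rhat Roff μ μt σ σt ρ) (hρ : |ρ| ≤ 1) (hσt : 0 < σt) (s : ℕ) :
    HasLaw (residual R Rhat μ μt (ρ * σ / σt) s)
      (gaussianReal 0 ((1 - ρ ^ 2) * σ ^ 2).toNNReal) P := by
  have hR := harm.law_reward hρ s
  have hRh := harm.law_surrogate hρ s
  have hg := harm.hasGaussianLaw_residual (ρ * σ / σt) s
  refine ⟨hg.aemeasurable, ?_⟩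
  rw [hg.map_eq_gaussianReal]
  congr 2
  · have h1 : Integrable (fun ω => R s ω - μ) P :=
      hR.hasGaussianLaw.integrable.sub (integrable_const μ)
    have h2 : Integrable (fun ω => Rhat s ω - μt) P :=
      hRh.hasGaussianLaw.integrable.sub (integrable_const μt)
    unfold residual
    rw [integral_sub h1 (h2.const_mul _),
      integral_const_mul, integral_sub hR.hasGaussianLaw.integrable (integrable_const μ),
      integral_sub hRh.hasGaussianLaw.integrable (integrable_const μt), hR.integral_eq,
      hRh.integral_eq, integral_id_gaussianReal, integral_id_gaussianReal]
    simp
  -- By orthogonality to the surrogate, Var(e) = cov(e, R) = σ² - βρσσt = (1-ρ²)σ².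
  · rw [← covariance_self hg.aemeasurable, harm.covariance_residual hρ _ s hg.memLp_two,
      covariance_comm (Rhat s), harm.covariance_residual_surrogate hρ hσt, covariance_comm,
      harm.covariance_residual hρ _ s hR.hasGaussianLaw.memLp_two, covariance_comm (Rhat s),
      harm.covariance_reward_surrogate hρ, covariance_self hR.aemeasurable, hR.variance_eq,
      variance_id_gaussianReal, Real.coe_toNNReal _ (by positivity)]
    field_simp
    ring

/-- The residuals and all the surrogate rewards are jointly independent. -/
lemma iIndepFun_residual_surrogates [IsProbabilityMeasure P]
    (harm : GaussianArm P R Rhat Roff μ μt σ σt ρ) (hρ : |ρ| ≤ 1) (hσt : 0 < σt) (n : ℕ) :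
    iIndepFun (Sum.elim (fun s : Fin n => residual R Rhat μ μt (ρ * σ / σt) s)
      (surrogates n Rhat Roff)) P := by
  set β := ρ * σ / σt with hβ
  have hon : HasGaussianLaw (fun ω (s : Fin n) => (R s ω, Rhat s ω)) P :=
    (harm.indep_pairs.precomp (g := fun s : Fin n => (s : ℕ)) Fin.val_injective).hasGaussianLaw
      fun s => harm.hasGaussianLaw_pair s
  have hoff : HasGaussianLaw (fun ω i => Roff i ω) P :=
    harm.indep_offline.hasGaussianLaw fun i => (harm.law_offline i).hasGaussianLaw
  have hind : IndepFun (fun ω i => Roff i ω) (fun ω (s : Fin n) => (R s ω, Rhat s ω)) P :=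
    harm.indep_offline_online.comp (φ := id)
      (ψ := fun (f : ℕ → ℝ × ℝ) (s : Fin n) => f (s : ℕ)) measurable_id (by fun_prop)
  have hjoint := hind.hasGaussianLaw hoff hon
  let fo (i : Fin N) : (Fin N → ℝ) × (Fin n → ℝ × ℝ) →L[ℝ] ℝ :=
    (ContinuousLinearMap.proj i).comp (ContinuousLinearMap.fst ℝ _ _)
  let fp (s : Fin n) : (Fin N → ℝ) × (Fin n → ℝ × ℝ) →L[ℝ] ℝ × ℝ :=
    (ContinuousLinearMap.proj s).comp (ContinuousLinearMap.snd ℝ _ _)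
  let fx (s : Fin n) := (ContinuousLinearMap.snd ℝ ℝ ℝ).comp (fp s)
  let fr (s : Fin n) := (ContinuousLinearMap.fst ℝ ℝ ℝ).comp (fp s)
  let L : (Fin N → ℝ) × (Fin n → ℝ × ℝ) →L[ℝ] (Fin n ⊕ (Fin n ⊕ Fin N) → ℝ) :=
    ContinuousLinearMap.pi (Sum.elim (fun s => fr s - β • fx s) (Sum.elim fx fo))
  have hL := hjoint.map_fun L
  -- The residuals without their constants are linear in the data; the shift by μ - βμt is restored
  -- at the end.
  let T : Fin n ⊕ (Fin n ⊕ Fin N) → Ω → ℝ :=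
    Sum.elim (fun s ω => R s ω - β * Rhat s ω) (surrogates n Rhat Roff)
  have hT : HasGaussianLaw (fun ω k => T k ω) P := by
    convert! hL using 2 with ω
    ext k
    rcases k with s | s | i <;> simp [T, L, fr, fx, fp, fo, surrogates]
  have hTm (k) : MemLp (T k) 2 P := (hT.eval k).memLp_two
  have hpair {s t : Fin n} (h : s ≠ t) :
      IndepFun (fun ω => (R s ω, Rhat s ω)) (fun ω => (R t ω, Rhat t ω)) P :=
    harm.indep_pairs.indepFun (by simpa [Fin.ext_iff] using h)
  have hcross (s : Fin n) (i : Fin N) : IndepFun (fun ω => (R s ω, Rhat s ω)) (Roff i) P :=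
    harm.indep_offline_online.symm.comp (φ := fun f : ℕ → ℝ × ℝ => f s)
      (ψ := fun f : Fin N → ℝ => f i)
      (by fun_prop) (by fun_prop)
  have hD : Measurable fun p : ℝ × ℝ => p.1 - β * p.2 := by fun_prop
  -- The only covariance that depends on the choice of β; the others vanish by independence of the
  -- data.
  have hdiag (s : Fin n) : cov[T (.inl s), T (.inr (.inl s)); P] = 0 := by
    have h := harm.covariance_residual_surrogate hρ hσt (s : ℕ)
    have hRh := (harm.law_surrogate hρ s).hasGaussianLaw
    have hR := (harm.law_reward hρ s).hasGaussianLaw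
    rw [harm.covariance_residual hρ _ _ hRh.memLp_two] at h
    change cov[fun ω => R s ω - β * Rhat s ω, Rhat s; P] = 0
    rw [covariance_fun_sub_left hR.memLp_two (hRh.memLp_two.const_mul β) hRh.memLp_two,
      covariance_const_mul_left, h]
  have hrx (s t : Fin n) : cov[T (.inl s), T (.inr (.inl t)); P] = 0 := by
    by_cases h : s = t
    · exact h ▸ hdiag s
    · exact ((hpair h).comp hD measurable_snd).covariance_eq_zero (hTm (.inl s))
        (hTm (.inr (.inl t)))
  have hro (s : Fin n) (i : Fin N) : cov[T (.inl s), T (.inr (.inr i)); P] = 0 :=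
    ((hcross s i).comp hD measurable_id).covariance_eq_zero (hTm (.inl s)) (hTm (.inr (.inr i)))
  have hxo (s : Fin n) (i : Fin N) : cov[T (.inr (.inl s)), T (.inr (.inr i)); P] = 0 :=
    ((hcross s i).comp measurable_snd measurable_id).covariance_eq_zero (hTm (.inr (.inl s)))
      (hTm (.inr (.inr i)))
  have hTi : iIndepFun T P := by
    refine hT.iIndepFun_of_covariance_eq_zero fun k l hkl => ?_
    rcases k with s | s | i <;> rcases l with t | t | j
    · exact ((hpair (by simpa using hkl)).comp hD hD).covariance_eq_zero (hTm (.inl s))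
        (hTm (.inl t))
    · exact hrx s t
    · exact hro s j
    · rw [covariance_comm]
      exact hrx t s
    · exact ((hpair (by simpa using hkl)).comp measurable_snd measurable_snd).covariance_eq_zero
        (hTm (.inr (.inl s))) (hTm (.inr (.inl t)))
    · exact hxo s j
    · rw [covariance_comm]
      exact hro t i
    · rw [covariance_comm]
      exact hxo t i
    · exact (harm.indep_offline.indepFun (by simpa using hkl)).covariance_eq_zero
        (hTm (.inr (.inr i))) (hTm (.inr (.inr j)))
  convert! hTi.comp (Sum.elim (fun _ x => x - (μ - β * μt)) fun _ => id) (by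
    rintro (s | j) <;> simp <;> fun_prop) using 1
  ext (s | j) ω
  · simp [T, residual]
    ring
  · rfl

lemma indepFun_residual_surrogates [IsProbabilityMeasure P]
    (harm : GaussianArm P R Rhat Roff μ μt σ σt ρ) (hρ : |ρ| ≤ 1) (hσt : 0 < σt) (n : ℕ) :
    IndepFun (fun ω j => surrogates n Rhat Roff j ω)
      (fun ω (s : Fin n) => residual R Rhat μ μt (ρ * σ / σt) s ω) P := by
  have h := harm.iIndepFun_residual_surrogates hρ hσt n
  have hm : ∀ k, Measurable (Sum.elim (fun s : Fin n => residual R Rhat μ μt (ρ * σ / σt) s)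
      (surrogates n Rhat Roff) k) := by
    rintro (s | j)
    · exact harm.measurable_residual _ s
    · exact harm.measurable_surrogates n j
  classical
  have h' := h.indepFun_finset (Finset.univ.map ⟨Sum.inr, Sum.inr_injective⟩)
    (Finset.univ.map ⟨Sum.inl, Sum.inl_injective⟩) (by
      rw [Finset.disjoint_left]
      rintro x hx hx'
      simp at hx hx'
      obtain ⟨a, rfl⟩ | ⟨a, rfl⟩ := hx <;> simp at hx') hm
  exact h'.comp (measurable_pi_lambda _ fun j => measurable_pi_apply ⟨Sum.inr j, by simp⟩)
    (measurable_pi_lambda _ fun s => measurable_pi_apply ⟨Sum.inl s, by simp⟩)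

end GaussianArm

end SurrogateBandit

/-! ### Algebra of the estimator. -/

namespace SurrogateBandit

/-- The weight of the `s`-th residual in the error of the estimator. -/
noncomputable def residualWeight (n : ℕ) {N : ℕ} (x : ℕ → ℝ) (y : Fin N → ℝ) (s : ℕ) : ℝ :=
  1 / (n : ℝ) - (N : ℝ) / ((n : ℝ) + N) * (onlineMean n x - offlineMean y) *
    ((x s - onlineMean n x) / ∑ t ∈ Finset.range n, (x t - onlineMean n x) ^ 2)

lemma sum_sub_onlineMean {n : ℕ} (hn : n ≠ 0) (x : ℕ → ℝ) :
    ∑ s ∈ Finset.range n, (x s - onlineMean n x) = 0 := by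
  have : (n : ℝ) ≠ 0 := by exact_mod_cast hn
  rw [Finset.sum_sub_distrib, Finset.sum_const, Finset.card_range, nsmul_eq_mul, onlineMean]
  field_simp
  ring

/-- Links the correction term of the estimator to the deviation appearing in Z. -/
lemma onlineMean_sub_pooledMean {n : ℕ} (hn : n ≠ 0) {N : ℕ} (x : ℕ → ℝ) (y : Fin N → ℝ) :
    onlineMean n x - pooledMean n x y =
      (N : ℝ) / ((n : ℝ) + N) * (onlineMean n x - offlineMean y) := by
  have hn' : (n : ℝ) ≠ 0 := by exact_mod_cast hn
  have hnN : (n : ℝ) + N ≠ 0 := by positivity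
  unfold onlineMean pooledMean offlineMean
  rcases eq_or_ne N 0 with rfl | hN
  · simp
  · have hN' : (N : ℝ) ≠ 0 := by exact_mod_cast hN
    field_simp
    ring

lemma sum_residualWeight_sq {n : ℕ} (hn : n ≠ 0) {N : ℕ} (x : ℕ → ℝ) (y : Fin N → ℝ) :
    ∑ s : Fin n, residualWeight n x y s ^ 2 = 1 / (n : ℝ) * zStat n x y := by
  have hn' : (n : ℝ) ≠ 0 := by exact_mod_cast hn
  rw [Fin.sum_univ_eq_sum_range (fun s => residualWeight n x y s ^ 2), zStat,
    onlineMean_sub_pooledMean hn]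
  unfold residualWeight
  set D := (N : ℝ) / ((n : ℝ) + N) * (onlineMean n x - offlineMean y)
  set Q := ∑ t ∈ Finset.range n, (x t - onlineMean n x) ^ 2 with hQ
  have h (s) : (1 / (n : ℝ) - D * ((x s - onlineMean n x) / Q)) ^ 2 =
      (1 / (n : ℝ)) ^ 2 - 2 / n * D / Q * (x s - onlineMean n x) +
        D ^ 2 / Q ^ 2 * (x s - onlineMean n x) ^ 2 := by ring
  simp_rw [h]
  rw [Finset.sum_add_distrib, Finset.sum_sub_distrib, ← Finset.mul_sum, ← Finset.mul_sum,
    sum_sub_onlineMean hn, ← hQ, Finset.sum_const, Finset.card_range, nsmul_eq_mul]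
  -- If Q = 0, division by zero makes every weight 1/n and Z = 1, so the identity still holds.
  rcases eq_or_ne Q 0 with h0 | h0
  · simp only [h0]
    field_simp
    simp
  · field_simp
    ring

lemma onlineMean_affine {n : ℕ} (hn : n ≠ 0) (e x : ℕ → ℝ) (μ μt β : ℝ) :
    onlineMean n (fun s => e s + μ + β * (x s - μt)) =
      onlineMean n e + μ + β * (onlineMean n x - μt) := by
  have hn' : (n : ℝ) ≠ 0 := by exact_mod_cast hn
  simp only [onlineMean, Finset.sum_add_distrib, ← Finset.mul_sum, Finset.sum_sub_distrib,
    Finset.sum_const, Finset.card_range, nsmul_eq_mul]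
  field_simp

/-- The error of the estimator splits into the error of the pooled mean and a weighted sum of
the regression residuals. -/
lemma mlaMean_decomposition {n : ℕ} (hn : n ≠ 0) {N : ℕ} (r x : ℕ → ℝ) (y : Fin N → ℝ)
    (μ μt β : ℝ) (hQ : ∑ t ∈ Finset.range n, (x t - onlineMean n x) ^ 2 ≠ 0) :
    mlaMean n r x y = μ + β * (pooledMean n x y - μt) +
      ∑ s : Fin n, residualWeight n x y s * (r s - μ - β * (x s - μt)) := by
  have hn' : (n : ℝ) ≠ 0 := by exact_mod_cast hn
  rw [Fin.sum_univ_eq_sum_range (fun s => residualWeight n x y s * (r s - μ - β * (x s - μt)))]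
  -- Passing to the residuals `e` as free variables makes the sample covariance split into a
  -- residual part and β times Q.
  obtain ⟨e, rfl⟩ : ∃ e : ℕ → ℝ, r = fun s => e s + μ + β * (x s - μt) :=
    ⟨fun s => r s - μ - β * (x s - μt), by ext; ring⟩
  have hpool : pooledMean n x y = onlineMean n x -
      (N : ℝ) / ((n : ℝ) + N) * (onlineMean n x - offlineMean y) := by
    rw [← onlineMean_sub_pooledMean hn]
    ring
  have hcov : sampleCov n (fun s => e s + μ + β * (x s - μt)) x = 1 / (n : ℝ) *
      (∑ s ∈ Finset.range n, (x s - onlineMean n x) * e s +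
        β * ∑ t ∈ Finset.range n, (x t - onlineMean n x) ^ 2) := by
    rw [sampleCov, onlineMean_affine hn]
    have h (s) : (e s + μ + β * (x s - μt) - (onlineMean n e + μ + β * (onlineMean n x - μt))) *
        (x s - onlineMean n x) = (x s - onlineMean n x) * e s + β * (x s - onlineMean n x) ^ 2 -
          onlineMean n e * (x s - onlineMean n x) := by ring
    simp_rw [h]
    rw [Finset.sum_sub_distrib, Finset.sum_add_distrib, ← Finset.mul_sum, ← Finset.mul_sum,
      sum_sub_onlineMean hn, mul_zero, sub_zero]
  rw [mlaMean, lambdaHat, hcov, sampleVar, onlineMean_affine hn, hpool]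
  unfold residualWeight
  set D := (N : ℝ) / ((n : ℝ) + N) * (onlineMean n x - offlineMean y) with hD
  set Q := ∑ t ∈ Finset.range n, (x t - onlineMean n x) ^ 2
  have h (s) : (1 / (n : ℝ) - D * ((x s - onlineMean n x) / Q)) *
      (e s + μ + β * (x s - μt) - μ - β * (x s - μt)) =
      1 / (n : ℝ) * e s - D / Q * ((x s - onlineMean n x) * e s) := by ring
  simp_rw [h]
  rw [Finset.sum_sub_distrib, ← Finset.mul_sum, ← Finset.mul_sum]
  set C := ∑ s ∈ Finset.range n, (x s - onlineMean n x) * e s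
  have hq : 1 / (n : ℝ) * (C + β * Q) / (1 / (n : ℝ) * Q) = C / Q + β := by
    field_simp
  rw [hq]
  have he : 1 / (n : ℝ) * ∑ s ∈ Finset.range n, e s = onlineMean n e := rfl
  rw [he]
  linear_combination (C / Q + β) * hD

/-- The variance inflation statistic in terms of the deviations from the pooled mean. -/
lemma zStat_eq_of_deviations {n : ℕ} (hn : n ≠ 0) {N : ℕ} (x : ℕ → ℝ) (y : Fin N → ℝ) :
    zStat n x y = 1 + n * ((1 / (n : ℝ)) * ∑ s : Fin n, (x s - pooledMean n x y)) ^ 2 /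
      ∑ s : Fin n, ((x s - pooledMean n x y) -
        (1 / (n : ℝ)) * ∑ t : Fin n, (x t - pooledMean n x y)) ^ 2 := by
  have hn' : (n : ℝ) ≠ 0 := by exact_mod_cast hn
  have h : (1 / (n : ℝ)) * ∑ s : Fin n, (x s - pooledMean n x y) =
      onlineMean n x - pooledMean n x y := by
    rw [Fin.sum_univ_eq_sum_range (fun s => x s - pooledMean n x y), Finset.sum_sub_distrib,
      Finset.sum_const, Finset.card_range, nsmul_eq_mul, onlineMean]
    field_simp
  rw [h]
  simp_rw [sub_sub_sub_cancel_right]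
  rw [Fin.sum_univ_eq_sum_range (fun s => (x s - onlineMean n x) ^ 2), zStat]

/-! ### Measurability with respect to the surrogate field. -/

section Surrogates

variable {Ω : Type*} {n N : ℕ} {Rhat : ℕ → Ω → ℝ} {Roff : Fin N → Ω → ℝ}

lemma pooledMean_eq_sum_surrogates (ω : Ω) :
    pooledMean n (fun s => Rhat s ω) (fun i => Roff i ω) =
      (1 / (Fintype.card (Fin n ⊕ Fin N) : ℝ)) * ∑ j, surrogates n Rhat Roff j ω := by
  simp [pooledMean, surrogates, Fintype.sum_sum_type,
    Fin.sum_univ_eq_sum_range (fun s => Rhat s ω)]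

lemma measurable_surrogateField_online {s : ℕ} (hs : s < n) :
    Measurable[surrogateField n Rhat Roff] (Rhat s) := by
  refine measurable_iff_comap_le.2 (le_trans ?_ le_sup_right)
  exact le_iSup (fun s : Fin n => MeasurableSpace.comap (Rhat s) inferInstance) ⟨s, hs⟩

lemma measurable_surrogateField_offline (i : Fin N) :
    Measurable[surrogateField n Rhat Roff] (Roff i) := by
  refine measurable_iff_comap_le.2 (le_trans ?_ le_sup_left)
  exact le_iSup (fun i : Fin N => MeasurableSpace.comap (Roff i) inferInstance) i

lemma surrogateField_le_comap :
    surrogateField n Rhat Roff ≤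
      MeasurableSpace.comap (fun ω j => surrogates n Rhat Roff j ω) MeasurableSpace.pi :=
  sup_le
    (iSup_le fun i => MeasurableSpace.comap_le_comap_pi (g := surrogates n Rhat Roff) (.inr i))
    (iSup_le fun s => MeasurableSpace.comap_le_comap_pi (g := surrogates n Rhat Roff) (.inl s))

lemma measurable_onlineMean_surrogate :
    Measurable[surrogateField n Rhat Roff] fun ω => onlineMean n fun s => Rhat s ω :=
  (Finset.measurable_fun_sum _ fun _ hs =>
    measurable_surrogateField_online (Finset.mem_range.1 hs)).const_mul _

lemma measurable_offlineMean :
    Measurable[surrogateField n Rhat Roff] fun ω => offlineMean fun i => Roff i ω :=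
  (Finset.measurable_fun_sum _ fun i _ => measurable_surrogateField_offline i).const_mul _

lemma measurable_pooledMean :
    Measurable[surrogateField n Rhat Roff]
      fun ω => pooledMean n (fun s => Rhat s ω) fun i => Roff i ω :=
  ((Finset.measurable_fun_sum _ fun _ hs =>
    measurable_surrogateField_online (Finset.mem_range.1 hs)).add
      (Finset.measurable_fun_sum _ fun i _ => measurable_surrogateField_offline i)).const_mul _

lemma measurable_sum_sq_surrogate :
    Measurable[surrogateField n Rhat Roff] fun ω =>
      ∑ s ∈ Finset.range n, (Rhat s ω - onlineMean n fun s => Rhat s ω) ^ 2 :=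
  Finset.measurable_fun_sum _ fun _ hs =>
    ((measurable_surrogateField_online (Finset.mem_range.1 hs)).sub
      measurable_onlineMean_surrogate).pow_const 2

lemma measurable_zStat :
    Measurable[surrogateField n Rhat Roff]
      fun ω => zStat n (fun s => Rhat s ω) fun i => Roff i ω :=
  ((((measurable_onlineMean_surrogate.sub measurable_pooledMean).pow_const 2).const_mul _).div
    measurable_sum_sq_surrogate).const_add 1

lemma measurable_residualWeight {s : ℕ} (hs : s < n) :
    Measurable[surrogateField n Rhat Roff]
      fun ω => residualWeight n (fun s => Rhat s ω) (fun i => Roff i ω) s :=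
  (((measurable_onlineMean_surrogate.sub measurable_offlineMean).const_mul _).mul
    (((measurable_surrogateField_online hs).sub measurable_onlineMean_surrogate).div
      measurable_sum_sq_surrogate)).const_sub _

end Surrogates

/-! ### Laws and independence of the surrogate statistics. -/

namespace GaussianArm

variable {Ω : Type*} [mΩ : MeasurableSpace Ω] {P : Measure Ω}
  {N : ℕ} {R Rhat : ℕ → Ω → ℝ} {Roff : Fin N → Ω → ℝ} {μ μt σ σt ρ : ℝ}

lemma surrogateField_le (harm : GaussianArm P R Rhat Roff μ μt σ σt ρ) (n : ℕ) :
    surrogateField n Rhat Roff ≤ mΩ :=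
  surrogateField_le_comap.trans
    (measurable_pi_lambda _ fun j => harm.measurable_surrogates n j).comap_le

lemma measurable_onlineMean_reward (harm : GaussianArm P R Rhat Roff μ μt σ σt ρ) (n : ℕ) :
    Measurable fun ω => onlineMean n fun s => R s ω :=
  (Finset.measurable_fun_sum _ fun s _ => harm.measurable_reward s).const_mul _

lemma measurable_mlaMean (harm : GaussianArm P R Rhat Roff μ μt σ σt ρ) (n : ℕ) :
    Measurable fun ω => mlaMean n (fun s => R s ω) (fun s => Rhat s ω) fun i => Roff i ω := by
  have hle := harm.surrogateField_le n
  have hx : Measurable fun ω => onlineMean n fun s => Rhat s ω :=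
    (measurable_onlineMean_surrogate (Roff := Roff)).mono hle le_rfl
  have hy : Measurable fun ω => offlineMean fun i => Roff i ω :=
    (measurable_offlineMean (n := n) (Rhat := Rhat)).mono hle le_rfl
  have hQ : Measurable fun ω =>
      ∑ s ∈ Finset.range n, (Rhat s ω - onlineMean n fun s => Rhat s ω) ^ 2 :=
    (measurable_sum_sq_surrogate (Roff := Roff)).mono hle le_rfl
  have hr := harm.measurable_onlineMean_reward n
  have hC : Measurable fun ω => sampleCov n (fun s => R s ω) fun s => Rhat s ω :=
    (Finset.measurable_fun_sum _ fun s _ => ((harm.measurable_reward s).sub hr).mul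
      ((harm.measurable_surrogate s).sub hx)).const_mul _
  exact hr.sub (((hC.div (hQ.const_mul _)).const_mul _).mul (hx.sub hy))

/-- Almost surely the online surrogate rewards are not all equal. -/
lemma ae_sum_sq_surrogate_ne_zero [IsProbabilityMeasure P]
    (harm : GaussianArm P R Rhat Roff μ μt σ σt ρ) (hρ : |ρ| ≤ 1) (hσt : 0 < σt) {n : ℕ}
    (hn : 2 ≤ n) :
    ∀ᵐ ω ∂P, ∑ s ∈ Finset.range n, (Rhat s ω - onlineMean n fun s => Rhat s ω) ^ 2 ≠ 0 := by
  -- Since n ≥ 2, Q = 0 would force the first two surrogates to agree, while their difference is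
  -- Gaussian with variance 2σt² > 0 and has no atom.
  have hind : IndepFun (Rhat 0) (fun ω => -Rhat 1 ω) P :=
    (harm.indep_pairs.indepFun zero_ne_one).comp (φ := Prod.snd) (ψ := fun p : ℝ × ℝ => -p.2)
      measurable_snd measurable_snd.neg
  have hlaw := gaussianReal_add_gaussianReal_of_indepFun hind (harm.law_surrogate hρ 0).map_eq
    (gaussianReal_neg (harm.law_surrogate hρ 1)).map_eq
  have hv : (σt ^ 2).toNNReal + (σt ^ 2).toNNReal ≠ 0 := by
    have : 0 < (σt ^ 2).toNNReal := Real.toNNReal_pos.2 (by positivity)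
    positivity
  have := nullSingletonClass_gaussianReal (μ := μt + -μt) hv
  have h0 : ∀ᵐ ω ∂P, (Rhat 0 + fun ω => -Rhat 1 ω) ω ≠ 0 := by
    refine ae_of_ae_map (f := Rhat 0 + fun ω => -Rhat 1 ω) (p := fun x => x ≠ 0)
      ((harm.measurable_surrogate 0).add (harm.measurable_surrogate 1).neg).aemeasurable ?_
    rw [hlaw]
    exact Measure.ae_ne _ 0
  filter_upwards [h0] with ω hω hsum
  rw [Finset.sum_eq_zero_iff_of_nonneg fun _ _ => sq_nonneg _] at hsum
  have h1 := pow_eq_zero_iff two_ne_zero |>.1 (hsum 0 (Finset.mem_range.2 (by omega)))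
  have h2 := pow_eq_zero_iff two_ne_zero |>.1 (hsum 1 (Finset.mem_range.2 (by omega)))
  refine hω ?_
  simp only [Pi.add_apply]
  linarith

lemma iIndepFun_surrogates [IsProbabilityMeasure P]
    (harm : GaussianArm P R Rhat Roff μ μt σ σt ρ) (hρ : |ρ| ≤ 1) (hσt : 0 < σt) (n : ℕ) :
    iIndepFun (surrogates n Rhat Roff) P :=
  (harm.iIndepFun_residual_surrogates hρ hσt n).precomp (g := Sum.inr)
    Sum.inr_injective

lemma iIndepFun_residual [IsProbabilityMeasure P]
    (harm : GaussianArm P R Rhat Roff μ μt σ σt ρ) (hρ : |ρ| ≤ 1) (hσt : 0 < σt) (n : ℕ) :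
    iIndepFun (fun s : Fin n => residual R Rhat μ μt (ρ * σ / σt) s) P :=
  (harm.iIndepFun_residual_surrogates hρ hσt n).precomp (g := Sum.inl)
    Sum.inl_injective

/-- Here n + N independent terms of variance σt² each carry the coefficient β/(n+N), and β²σt² =
ρ²σ². -/
lemma hasLaw_pooledMean [IsProbabilityMeasure P]
    (harm : GaussianArm P R Rhat Roff μ μt σ σt ρ) (hρ : |ρ| ≤ 1) (hσt : 0 < σt) {n : ℕ}
    (hn : n ≠ 0) :
    HasLaw (fun ω => ρ * σ / σt *
        (pooledMean n (fun s => Rhat s ω) (fun i => Roff i ω) - μt))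
      (gaussianReal 0 ((1 / ((n : ℝ) + N)) * ρ ^ 2 * σ ^ 2).toNNReal) P := by
  have hn' : (n : ℝ) ≠ 0 := by exact_mod_cast hn
  have hnN : (n : ℝ) + N ≠ 0 := by positivity
  have hlaw (j) : HasLaw (fun ω => surrogates n Rhat Roff j ω - μt)
      (gaussianReal 0 (σt ^ 2).toNNReal) P := by
    simpa using gaussianReal_sub_const (harm.law_surrogates hρ n j) μt
  have hind : iIndepFun (fun j ω => surrogates n Rhat Roff j ω - μt) P :=
    (harm.iIndepFun_surrogates hρ hσt n).comp (fun _ x => x - μt) (by fun_prop)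
  convert! hasLaw_sum_mul_gaussianReal (sq_nonneg σt) hlaw hind
    (fun _ => ρ * σ / σt * (1 / ((n : ℝ) + N))) using 1
  · ext ω
    rw [pooledMean_eq_sum_surrogates, ← Finset.mul_sum, Finset.sum_sub_distrib]
    simp
    field_simp
  · congr 2
    simp
    field_simp

lemma indepFun_pooledMean_zStat [IsProbabilityMeasure P]
    (harm : GaussianArm P R Rhat Roff μ μt σ σt ρ) (hρ : |ρ| ≤ 1) (hσt : 0 < σt) {n : ℕ}
    (hn : n ≠ 0) :
    IndepFun (fun ω => pooledMean n (fun s => Rhat s ω) (fun i => Roff i ω))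
      (fun ω => zStat n (fun s => Rhat s ω) (fun i => Roff i ω)) P := by
  have h := indepFun_sum_sub_mean (harm.law_surrogates hρ n) (harm.iIndepFun_surrogates hρ hσt n)
  -- Z as a function of the deviations from the pooled mean alone.
  let g : (Fin n ⊕ Fin N → ℝ) → ℝ := fun d =>
    1 + n * ((1 / (n : ℝ)) * ∑ s : Fin n, d (.inl s)) ^ 2 /
      ∑ s : Fin n, (d (.inl s) - (1 / (n : ℝ)) * ∑ t : Fin n, d (.inl t)) ^ 2
  have hg : Measurable g := by fun_prop
  convert! h.comp (measurable_const_mul (1 / (Fintype.card (Fin n ⊕ Fin N) : ℝ))) hg using 1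
  · ext ω
    exact pooledMean_eq_sum_surrogates ω
  · ext ω
    rw [zStat_eq_of_deviations hn, pooledMean_eq_sum_surrogates]
    rfl

end GaussianArm

end SurrogateBandit

/-! ### Assembling the decomposition. -/

theorem mainTheorem3 {Ω : Type*} [MeasurableSpace Ω] (P : Measure Ω) [IsProbabilityMeasure P]
    (n N : ℕ) (hn : 2 ≤ n)
    (R Rhat : ℕ → Ω → ℝ) (Roff : Fin N → Ω → ℝ)
    (μ μt σ σt ρ : ℝ) (hσ : 0 ≤ σ) (hσt : 0 < σt) (hρ : |ρ| ≤ 1)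
    (harm : SurrogateBandit.GaussianArm P R Rhat Roff μ μt σ σt ρ) :
    Measurable[SurrogateBandit.surrogateField n Rhat Roff]
        (fun ω => SurrogateBandit.zStat n (fun s => Rhat s ω) (fun i => Roff i ω)) ∧
      ∃ S₁ S₂ : Ω → ℝ,
        (∀ ω, SurrogateBandit.mlaMean n (fun s => R s ω) (fun s => Rhat s ω) (fun i => Roff i ω)
          = μ + S₁ ω + S₂ ω) ∧
        Measurable[SurrogateBandit.surrogateField n Rhat Roff] S₁ ∧
        Measurable S₂ ∧
        IndepFun S₁ S₂ P ∧
        HasLaw S₁ (gaussianReal 0 ((1 / ((n : ℝ) + N)) * ρ ^ 2 * σ ^ 2).toNNReal) P ∧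
        SurrogateBandit.CondCentredGaussian P (SurrogateBandit.surrogateField n Rhat Roff) S₂
          (fun ω => (1 / (n : ℝ)) *
            SurrogateBandit.zStat n (fun s => Rhat s ω) (fun i => Roff i ω) *
            (1 - ρ ^ 2) * σ ^ 2) := by
  have hn0 : n ≠ 0 := by omega
  have hF := harm.surrogateField_le n
  have hS₁ : Measurable[SurrogateBandit.surrogateField n Rhat Roff] fun ω => ρ * σ / σt *
      (SurrogateBandit.pooledMean n (fun s => Rhat s ω) (fun i => Roff i ω) - μt) :=
    (SurrogateBandit.measurable_pooledMean.sub_const μt).const_mul _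
  -- S₂ is taken as the remainder, so that the decomposition holds at every ω; it equals the
  -- weighted residual sum only off the null event Q = 0.
  have hS₂ : Measurable fun ω =>
      SurrogateBandit.mlaMean n (fun s => R s ω) (fun s => Rhat s ω) (fun i => Roff i ω) - μ -
        ρ * σ / σt *
          (SurrogateBandit.pooledMean n (fun s => Rhat s ω) (fun i => Roff i ω) - μt) :=
    ((harm.measurable_mlaMean n).sub_const μ).sub (hS₁.mono hF le_rfl)
  have hv : 0 ≤ (1 - ρ ^ 2) * σ ^ 2 :=
    mul_nonneg (sub_nonneg.2 ((sq_le_one_iff_abs_le_one ρ).2 hρ)) (sq_nonneg σ)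
  have hcond := SurrogateBandit.condCentredGaussian_sum_mul hF hv
    (fun s : Fin n => harm.measurable_residual (ρ * σ / σt) s)
    (fun s => harm.law_residual hρ hσt s) (harm.iIndepFun_residual hρ hσt n)
    (fun s => SurrogateBandit.measurable_residualWeight s.2)
    (indep_of_indep_of_le_left (harm.indepFun_residual_surrogates hρ hσt n)
      SurrogateBandit.surrogateField_le_comap) hS₂ (by
        filter_upwards [harm.ae_sum_sq_surrogate_ne_zero hρ hσt hn] with ω hω
        rw [SurrogateBandit.mlaMean_decomposition hn0 _ _ _ μ μt (ρ * σ / σt) hω]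
        simp only [SurrogateBandit.residual]
        ring)
  simp_rw [SurrogateBandit.sum_residualWeight_sq hn0, ← mul_assoc] at hcond
  refine ⟨SurrogateBandit.measurable_zStat, _, _, fun ω => by ring, hS₁, hS₂, ?_,
    harm.hasLaw_pooledMean hρ hσt hn0, hcond⟩
  -- What remains is independence of S₁ from the conditional variance of S₂, a function of Z.
  refine hcond.indepFun hF hS₂ hS₁ ?_
  exact (harm.indepFun_pooledMean_zStat hρ hσt hn0).comp
    (φ := fun p => ρ * σ / σt * (p - μt)) (ψ := fun z => 1 / (n : ℝ) * z * (1 - ρ ^ 2) * σ ^ 2)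
    (by fun_prop) (by fun_prop)
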